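/- Let $\mathbf{Mfld}$ be the site of smooth manifolds (finite-dimensional, without boundary, Hausdorff, second countable) and smooth maps, with coverings the covers by open subsets, and let $*$ be the one-point manifold. A presheaf of sets $P$ on $\mathbf{Mfld}$ is concrete if for every manifold $M$ the map $P(M)\to \mathrm{Map}(\mathrm{Hom}(*,M),P(*))$, $p\mapsto(u\mapsto u^*p)$, is injective; concrete sheaves form a full subcategory of the category of sheaves of sets on $\mathbf{Mfld}$. For a stack $\mathcal X$ over $\mathbf{Mfld}$ (a category fibered in groupoids satisfying descent) let $\pi_0(\mathcal X)$ be the presheaf $M\mapsto\{\text{isomorphism classes of objects of }\mathcal X(M)\}$ and let $\mathrm{discr}(\mathcal X)$ be its sheafification; let $\mathrm{coarse}(\mathcal X)$ be the sheafification of the presheaf $M\mapsto \mathrm{discr}(\mathcal X)(M)/{\sim}$, where $p_1\sim p_2$ if $u^*p_1=u^*p_2$ for all $u\colon *\to M$; it is a concrete sheaf. For a diffeological space $X$ let $I(X)$ be the associated concrete sheaf, whose sections over $M$ are the maps $M\to X$ that are given locally, in charts, by plots. For a Lie groupoid $G=(G_1\rightrightarrows G_0)$ let $BG$ be the stack of right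 principal $G$-bundles over manifolds, and let the orbit space $G_0/G_1$ carry the quotient diffeology, whose plots are the maps that lift locally to smooth maps into $G_0$. Theorem. Let $\mathcal X$ be a stack over $\mathbf{Mfld}$ and $G=(G_1\rightrightarrows G_0)$ a Lie groupoid representing $\mathcal X$, that is, $\mathcal X$ is equivalent to $BG$ as a stack. Then $\mathrm{coarse}(\mathcal X)\cong I(G_0/G_1)$ as concrete sheaves. Consequently, this diffeology depends only on the isomorphism class of the stack: if $\mathcal Y$ is a stack equivalent to $\mathcal X$, then $\mathrm{coarse}(\mathcal X)\cong\mathrm{coarse}(\mathcal Y)$, and if moreover $H=(H_1\rightrightarrows H_0)$ is a Lie groupoid representing $\mathcal Y$, then $G_0/G_1$ and $H_0/H_1$ with their quotient diffeologies are diffeologically diffeomorphic. -/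

import Mathlib

open CategoryTheory Opposite Diffeology
open scoped Manifold ContDiff Bicategory

/-! ### The site of smooth manifolds -/

/-- A smooth manifold: finite-dimensional, without boundary, Hausdorff, second countable. -/
structure Mfld : Type 1 where
  carrier : Type
  dim : ℕ
  [top : TopologicalSpace carrier]
  [charted : ChartedSpace (EuclideanSpace ℝ (Fin dim)) carrier]
  [isManifold : IsManifold (𝓡 dim) ∞ carrier]
  [t2 : T2Space carrier]
  [secondCountable : SecondCountableTopology carrier]

namespace Mfld

instance : CoeSort Mfld Type := ⟨Mfld.carrier⟩

attribute [instance] Mfld.top Mfld.charted Mfld.isManifold Mfld.t2 Mfld.secondCountable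

/-- Smooth maps of manifolds. -/
@[ext]
structure Hom (M N : Mfld) : Type where
  toFun : M → N
  smooth : ContMDiff (𝓡 M.dim) (𝓡 N.dim) ∞ toFun

instance : Category Mfld where
  Hom := Hom
  id M := ⟨id, contMDiff_id⟩
  comp f g := ⟨g.toFun ∘ f.toFun, g.smooth.comp f.smooth⟩

instance (M N : Mfld) : FunLike (M ⟶ N) M N where
  coe f := Hom.toFun f
  coe_injective _ _ h := Hom.ext h

theorem hom_smooth {M N : Mfld} (f : M ⟶ N) : ContMDiff (𝓡 M.dim) (𝓡 N.dim) ∞ (f : M → N) :=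
  Hom.smooth f

@[ext]
theorem hom_ext {M N : Mfld} {f g : M ⟶ N} (h : ∀ x, f x = g x) : f = g :=
  DFunLike.ext f g h

/-- A smooth map as a morphism. -/
def homMk {M N : Mfld} (f : M → N) (hf : ContMDiff (𝓡 M.dim) (𝓡 N.dim) ∞ f) : M ⟶ N :=
  Hom.mk f hf

@[simp]
theorem homMk_apply {M N : Mfld} (f : M → N) (hf : ContMDiff (𝓡 M.dim) (𝓡 N.dim) ∞ f) (x : M) :
    homMk f hf x = f x := rfl

@[simp]
theorem id_apply {M : Mfld} (x : M) : (𝟙 M : M ⟶ M) x = x := rfl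

@[simp]
theorem comp_apply {M N K : Mfld} (f : M ⟶ N) (g : N ⟶ K) (x : M) : (f ≫ g) x = g (f x) := rfl

/-- Submersions of manifolds. -/
def IsSubmersion {M N : Mfld} (f : M ⟶ N) : Prop :=
  Manifold.IsSubmersion (𝓡 M.dim) (𝓡 N.dim) ∞ (f : M → N)

/-- An open subset of a manifold, as a manifold. -/
noncomputable abbrev ofOpens (M : Mfld) (U : TopologicalSpace.Opens M) : Mfld where
  carrier := U
  dim := M.dim

/-- The inclusion of an open subset. -/
noncomputable def inclusion (M : Mfld) (U : TopologicalSpace.Opens M) : M.ofOpens U ⟶ M :=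
  homMk (M := M.ofOpens U) (N := M) (Subtype.val : U → M)
    (contMDiff_subtype_val (I := 𝓡 M.dim))

@[simp]
theorem inclusion_apply (M : Mfld) (U : TopologicalSpace.Opens M) (x : U) :
    M.inclusion U x = x.1 := rfl

/-- A smooth map with values in an open subset factors through the inclusion. -/
noncomputable def lift {M N : Mfld} (f : N ⟶ M) (U : TopologicalSpace.Opens M) (h : ∀ x, f x ∈ U) :
    N ⟶ M.ofOpens U :=
  homMk (M := N) (N := M.ofOpens U) (fun x => (⟨f x, h x⟩ : U))
    ((ContMDiff.subtypeVal_comp_iff (I' := 𝓡 M.dim) U (fun x => (⟨f x, h x⟩ : U))).1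
      (hom_smooth f))

theorem lift_inclusion {M N : Mfld} (f : N ⟶ M) (U : TopologicalSpace.Opens M)
    (h : ∀ x, f x ∈ U) : lift f U h ≫ M.inclusion U = f := rfl

/-- The Euclidean space `ℝⁿ`. -/
def euclidean (n : ℕ) : Mfld where
  carrier := EuclideanSpace ℝ (Fin n)
  dim := n

/-- The one-point manifold `*`. -/
def pt : Mfld := euclidean 0

/-- The unique point of `*`. -/
def star : pt := (0 : EuclideanSpace ℝ (Fin 0))

/-- A point of `M` as a morphism `* ⟶ M`. -/
def point {M : Mfld} (x : M) : pt ⟶ M := homMk (fun _ => x) contMDiff_const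

@[simp]
theorem point_apply {M : Mfld} (x : M) (u : pt) : point x u = x := rfl

@[simp]
theorem point_comp {M N : Mfld} (x : M) (f : M ⟶ N) : point x ≫ f = point (f x) := rfl

theorem eq_point {M : Mfld} (u : pt ⟶ M) : u = point (u star) := by
  ext x
  have : x = star := Subsingleton.elim (α := EuclideanSpace ℝ (Fin 0)) x star
  subst this
  rfl

/-- The topology of open covers: a sieve on `M` covers `M` if it contains the inclusions of the
members of some open cover of `M`. -/
def openTopology : GrothendieckTopology Mfld where
  sieves M := {R | ∀ x : M, ∃ U : TopologicalSpace.Opens M, x ∈ U ∧ R (M.inclusion U)}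
  top_mem' M x := ⟨⊤, trivial, trivial⟩
  pullback_stable' := by
    intro M N R f hR x
    obtain ⟨U, hx, hU⟩ := hR (f x)
    let V : TopologicalSpace.Opens N :=
      ⟨f ⁻¹' (U : Set M), U.isOpen.preimage (hom_smooth f).continuous⟩
    refine ⟨V, hx, ?_⟩
    have h : N.inclusion V ≫ f = lift (N.inclusion V ≫ f) U (fun y => y.2) ≫ M.inclusion U := rfl
    change R (N.inclusion V ≫ f)
    rw [h]
    exact R.downward_closed hU _
  transitive' := by
    intro M R hR S hS x
    obtain ⟨U, hx, hU⟩ := hR x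
    obtain ⟨V, hxV, hV⟩ := hS hU (⟨x, hx⟩ : U)
    let W : TopologicalSpace.Opens M :=
      ⟨Subtype.val '' V.carrier, U.isOpen.isOpenMap_subtype_val _ V.isOpen⟩
    have hWU : ∀ y : W, (y : M) ∈ U := by
      rintro ⟨_, z, _, rfl⟩
      exact z.2
    have hWV : ∀ y : W, (⟨(y : M), hWU y⟩ : U) ∈ V := by
      rintro ⟨_, z, hz, rfl⟩
      exact hz
    refine ⟨W, ⟨⟨x, hx⟩, hxV, rfl⟩, ?_⟩
    have h : M.inclusion W =
      lift (M := M.ofOpens U) (lift (M.inclusion W) U hWU) V hWV ≫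
        (M.ofOpens U).inclusion V ≫ M.inclusion U := rfl
    rw [h]
    exact S.downward_closed hV _

theorem mem_openTopology {M : Mfld} (R : Sieve M) :
    R ∈ openTopology M ↔
      ∀ x : M, ∃ U : TopologicalSpace.Opens M, x ∈ U ∧ R (M.inclusion U) := Iff.rfl

/-- A covering sieve contains every point. -/
theorem point_mem {M : Mfld} {R : Sieve M} (hR : R ∈ openTopology M) (x : M) : R (point x) := by
  obtain ⟨U, hx, hU⟩ := hR x
  exact R.downward_closed hU (point (M := M.ofOpens U) (⟨x, hx⟩ : U))

end Mfld

/-! ### Concrete sheaves -/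

/-- A presheaf of sets on manifolds is concrete if its sections are determined by their values at
points, i.e. `p ↦ (u ↦ u^* p)`, `P(M) → (Hom(*, M) → P(*))`, is injective for every `M`. -/
def IsConcrete (P : Mfldᵒᵖ ⥤ Type 1) : Prop :=
  ∀ M : Mfld, Function.Injective
    (fun (p : P.obj (op M)) (u : Mfld.pt ⟶ M) => P.map u.op p)

/-- Concrete sheaves on manifolds, a full subcategory of the category of sheaves of sets. -/
abbrev ConcreteSheaf : Type 2 :=
  ObjectProperty.FullSubcategory
    (fun S : Sheaf Mfld.openTopology (Type 1) => IsConcrete S.obj)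

/-- Two sections are identified when they have the same value at every point. -/
def concretizationSetoid (P : Mfldᵒᵖ ⥤ Type 1) (M : Mfld) : Setoid (P.obj (op M)) where
  r p q := ∀ u : Mfld.pt ⟶ M, P.map u.op p = P.map u.op q
  iseqv := ⟨fun _ _ => rfl, fun h u => (h u).symm, fun h k u => (h u).trans (k u)⟩

/-- The presheaf `κ(P)`, `M ↦ P(M)/∼`. -/
def kappa (P : Mfldᵒᵖ ⥤ Type 1) : Mfldᵒᵖ ⥤ Type 1 where
  obj M := Quotient (concretizationSetoid P M.unop)
  map {M N} f := ↾(Quotient.map (P.map f) (by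
    intro p q h u
    have := h (u ≫ f.unop)
    simpa using this))
  map_id M := by
    ext x
    induction x using Quotient.inductionOn
    simp
  map_comp f g := by
    ext x
    induction x using Quotient.inductionOn
    apply Quotient.sound
    intro u
    simp

theorem kappa_isConcrete (P : Mfldᵒᵖ ⥤ Type 1) : IsConcrete (kappa P) := by
  intro M p q h
  induction p using Quotient.inductionOn with | _ p
  induction q using Quotient.inductionOn with | _ q
  apply Quotient.sound
  intro u
  have h1 := Quotient.exact (congrFun h u) (𝟙 _)
  simpa using h1

theorem isConcrete_sheafify (P : Mfldᵒᵖ ⥤ Type 1) (hP : IsConcrete P) :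
    IsConcrete (sheafify Mfld.openTopology P) := by
  intro M p q h
  let η := toSheafify Mfld.openTopology P
  have hS := (isSheaf_iff_isSheaf_of_type _ _).1 
    ((presheafToSheaf Mfld.openTopology (Type 1)).obj P).property
  have hcov := Mfld.openTopology.intersection_covering
    (Presheaf.imageSieve_mem Mfld.openTopology η p)
    (Presheaf.imageSieve_mem Mfld.openTopology η q)
  refine (hS _ hcov).isSeparatedFor.ext ?_
  rintro N f ⟨⟨a, ha⟩, ⟨b, hb⟩⟩
  have hab : a = b := by
    apply hP N
    funext u
    have h1 : η.app (op Mfld.pt) (P.map u.op a) = η.app (op Mfld.pt) (P.map u.op b) := by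
      have h2 := congrFun h (u ≫ f)
      simp only [op_comp, Functor.map_comp] at h2
      have h3 : (sheafify Mfld.openTopology P).map u.op (η.app (op N) a) =
          (sheafify Mfld.openTopology P).map u.op (η.app (op N) b) := by
        rw [ha, hb]
        simpa using h2
      simpa [NatTrans.naturality_apply] using h3
    have h4 := Mfld.point_mem (Presheaf.equalizerSieve_mem Mfld.openTopology η _ _ h1) Mfld.star
    have h5 : Mfld.point Mfld.star = 𝟙 Mfld.pt := (Mfld.eq_point (𝟙 Mfld.pt)).symm
    rw [h5] at h4
    simpa [Presheaf.equalizerSieve] using h4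
  rw [← ha, ← hb, hab]

/-- The concretization of a presheaf of sets: the sheafification of `κ(P)`. -/
noncomputable def concretization (P : Mfldᵒᵖ ⥤ Type 1) : ConcreteSheaf where
  obj := (presheafToSheaf Mfld.openTopology (Type 1)).obj (kappa P)
  property := isConcrete_sheafify _ (kappa_isConcrete P)

/-! ### Stacks over manifolds -/

/-- The slice category over `M`, as a category over manifolds. -/
def sliceBased (M : Mfld) : BasedCategory.{0, 1} Mfld := BasedCategory.ofFunctor (Over.forget M)

/-- A sieve on `M`, as a full subcategory of the slice over `M`. -/
def sieveBased {M : Mfld} (R : Sieve M) : BasedCategory.{0, 1} Mfld :=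
  BasedCategory.ofFunctor R.arrows.diagram

/-- The inclusion of a sieve into the slice. -/
def sieveInclusion {M : Mfld} (R : Sieve M) : BasedFunctor (sieveBased R) (sliceBased M) where
  toFunctor := ObjectProperty.ι _
  w := rfl

/-- The functor from maps `Mfld/M → 𝒳` to maps `R → 𝒳`, i.e. from objects of `𝒳` over `M`
(with chosen pullbacks) to descent data for `R` in `𝒳`. -/
def sieveRestriction (𝒳 : BasedCategory.{0, 1} Mfld) {M : Mfld} (R : Sieve M) :
    BasedFunctor (sliceBased M) 𝒳 ⥤ BasedFunctor (sieveBased R) 𝒳 where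
  obj F := (sieveInclusion R).comp F
  map α := BasedCategory.whiskerLeft (sieveInclusion R) α

/-- Categories fibered in groupoids over manifolds. -/
class IsFiberedInGroupoids (𝒳 : BasedCategory.{0, 1} Mfld) : Prop where
  isFibered : 𝒳.p.IsFibered
  isGroupoid : ∀ M : Mfld, IsGroupoid (𝒳.p.Fiber M)

attribute [instance] IsFiberedInGroupoids.isFibered IsFiberedInGroupoids.isGroupoid

/-- Stacks over manifolds: categories fibered in groupoids such that objects and arrows satisfy
descent for covering sieves. (In a category fibered in groupoids every arrow is cartesian, so
that based functors automatically preserve cartesian arrows.) -/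
class IsStack (𝒳 : BasedCategory.{0, 1} Mfld) : Prop extends IsFiberedInGroupoids 𝒳 where
  descent : ∀ (M : Mfld) (R : Sieve M), R ∈ Mfld.openTopology M →
    (sieveRestriction 𝒳 R).IsEquivalence

section Discretization

open Functor.IsPreFibered

variable (𝒳 : BasedCategory.{0, 1} Mfld) [IsFiberedInGroupoids 𝒳]

/-- The pullback `f^* a` of an object over `M` along `f : N ⟶ M`. -/
noncomputable def pullbackFiber {M N : Mfld} (f : N ⟶ M) (a : 𝒳.p.Fiber M) : 𝒳.p.Fiber N :=
  ⟨pullbackObj a.2 f, pullbackObj_proj a.2 f⟩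

theorem isIsomorphic_pullbackFiber {M N : Mfld} (f : N ⟶ M) (a : 𝒳.p.Fiber M)
    (b : 𝒳.p.Fiber N) (φ : b.1 ⟶ a.1) [𝒳.p.IsCartesian f φ] :
    IsIsomorphic b (pullbackFiber 𝒳 f a) := by
  let e := Functor.IsCartesian.domainUniqueUpToIso 𝒳.p f (pullbackMap a.2 f) φ
  have h1 : 𝒳.p.IsHomLift (𝟙 N) e.hom :=
    inferInstanceAs (𝒳.p.IsHomLift (𝟙 N) (Functor.IsCartesian.map 𝒳.p f (pullbackMap a.2 f) φ))
  have h2 : 𝒳.p.IsHomLift (𝟙 N) e.inv :=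
    inferInstanceAs (𝒳.p.IsHomLift (𝟙 N) (Functor.IsCartesian.map 𝒳.p f φ (pullbackMap a.2 f)))
  exact ⟨{ hom := ⟨e.hom, h1⟩
           inv := ⟨e.inv, h2⟩
           hom_inv_id := Subtype.ext e.hom_inv_id
           inv_hom_id := Subtype.ext e.inv_hom_id }⟩

/-- The presheaf `π₀(𝒳)` of isomorphism classes of objects. -/
noncomputable def piZero : Mfldᵒᵖ ⥤ Type 1 where
  obj M := Quotient (isIsomorphicSetoid (𝒳.p.Fiber M.unop))
  map {M N} f := ↾(Quotient.map (pullbackFiber 𝒳 f.unop) (by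
    rintro a b ⟨e⟩
    let e' : a.1 ≅ b.1 := Functor.Fiber.fiberInclusion.mapIso e
    have : 𝒳.p.IsHomLift (𝟙 M.unop) e'.hom := e.hom.2
    have hc : 𝒳.p.IsCartesian f.unop (pullbackMap a.2 f.unop ≫ e'.hom) := inferInstance
    exact @isIsomorphic_pullbackFiber 𝒳 _ _ _ f.unop b (pullbackFiber 𝒳 f.unop a)
      (pullbackMap a.2 f.unop ≫ e'.hom) hc))
  map_id M := by
    ext x
    induction x using Quotient.inductionOn with | _ a
    have : 𝒳.p.IsHomLift (𝟙 M.unop) (𝟙 a.1) := IsHomLift.id a.2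
    have : 𝒳.p.IsCartesian (𝟙 M.unop) (𝟙 a.1) := inferInstance
    exact (Quotient.sound (isIsomorphic_pullbackFiber 𝒳 (𝟙 M.unop) a a (𝟙 _))).symm
  map_comp {M N K} f g := by
    ext x
    induction x using Quotient.inductionOn with | _ a
    have hc : 𝒳.p.IsCartesian (g.unop ≫ f.unop)
        (pullbackMap (pullbackObj_proj a.2 f.unop) g.unop ≫ pullbackMap a.2 f.unop) :=
      inferInstance
    exact (Quotient.sound (@isIsomorphic_pullbackFiber 𝒳 _ _ _ (g.unop ≫ f.unop) a
      (pullbackFiber 𝒳 g.unop (pullbackFiber 𝒳 f.unop a)) _ hc)).symm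

/-- The discretization of a stack: the sheafification of `π₀(𝒳)`. -/
noncomputable def discretization : Sheaf Mfld.openTopology (Type 1) :=
  (presheafToSheaf Mfld.openTopology (Type 1)).obj (piZero 𝒳)

/-- The diffeological coarse moduli space of a stack: the concretization of its
discretization. -/
noncomputable def coarse : ConcreteSheaf := concretization (discretization 𝒳).obj

end Discretization

/-! ### Diffeological spaces as concrete sheaves -/

section Diffeology

variable {X : Type} [DiffeologicalSpace X]

/-- A map `p` is a plot on an open set `U ⊆ ℝⁿ` (only its values on `U` matter): every smooth
reparametrization `ℝᵐ → U` turns it into a plot. -/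
def IsPlotOn {n : ℕ} (U : Set (EuclideanSpace ℝ (Fin n))) (p : EuclideanSpace ℝ (Fin n) → X) :
    Prop :=
  ∀ (m : ℕ) (g : EuclideanSpace ℝ (Fin m) → EuclideanSpace ℝ (Fin n)),
    (∀ x, g x ∈ U) → ContDiff ℝ ∞ g → IsPlot (p ∘ g)

/-- A map from a manifold to a diffeological space that is given locally, in charts, by plots. -/
def IsLocallyPlot (M : Mfld) (p : M → X) : Prop :=
  ∀ x : M, ∃ e ∈ IsManifold.maximalAtlas (𝓡 M.dim) ∞ M, x ∈ e.source ∧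
    IsPlotOn e.target (p ∘ e.symm)

theorem isLocallyPlot_iff {M : Mfld} {p : M → X} :
    IsLocallyPlot M p ↔
      ∀ (n : ℕ) (f : Mfld.euclidean n ⟶ M), IsPlot (n := n) (p ∘ f) := by
  constructor
  · intro hp n f
    refine DiffeologicalSpace.locality fun x => ?_
    obtain ⟨e, he, hx, hpe⟩ := hp (f x)
    refine ⟨f ⁻¹' e.source, e.open_source.preimage (Mfld.hom_smooth f).continuous, hx, ?_⟩
    intro m g hg hgs
    let F : EuclideanSpace ℝ (Fin n) → M := f
    have h1 : (p ∘ e.symm) ∘ (e ∘ F ∘ g) = (p ∘ F) ∘ g := by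
      funext y
      exact congrArg p (e.left_inv (hg y))
    suffices h0 : IsPlot ((p ∘ e.symm) ∘ (e ∘ F ∘ g)) by
      rw [h1] at h0
      exact h0
    refine hpe m _ (fun y => e.map_source (hg y)) ?_
    rw [← contMDiff_iff_contDiff]
    have h2 : ContMDiff (𝓡 m) (𝓡 M.dim) ∞ (F ∘ g) :=
      (Mfld.hom_smooth f).comp (contMDiff_iff_contDiff.2 hgs)
    intro y
    exact (contMDiffAt_of_mem_maximalAtlas he (hg y)).comp y (h2 y)
  · intro hp x
    refine ⟨chartAt _ x, IsManifold.chart_mem_maximalAtlas x, mem_chart_source _ x, ?_⟩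
    intro m g hg hgs
    have h1 : ContMDiff (𝓡 m) (𝓡 M.dim) ∞
        ((chartAt (EuclideanSpace ℝ (Fin M.dim)) x).symm ∘ g) := by
      intro y
      exact (contMDiffAt_symm_of_mem_maximalAtlas
        (IsManifold.chart_mem_maximalAtlas (I := 𝓡 M.dim) (n := ∞) x) (hg y)).comp y
          (contMDiff_iff_contDiff.2 hgs y)
    exact hp m (Mfld.homMk (M := Mfld.euclidean m) _ h1)

theorem IsLocallyPlot.comp {M N : Mfld} {p : M → X} (hp : IsLocallyPlot M p) (f : N ⟶ M) :
    IsLocallyPlot N (p ∘ f) :=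
  isLocallyPlot_iff.2 fun n g => isLocallyPlot_iff.1 hp n (g ≫ f)

variable (X)

/-- The presheaf of maps that are locally plots. -/
def plotPresheaf : Mfldᵒᵖ ⥤ Type 1 where
  obj M := ULift.{1} {p : M.unop → X // IsLocallyPlot M.unop p}
  map f := ↾(fun p => ⟨⟨p.down.1 ∘ f.unop, p.down.2.comp f.unop⟩⟩)

theorem plotPresheaf_isConcrete : IsConcrete (plotPresheaf X) := by
  rintro M ⟨p, hp⟩ ⟨q, hq⟩ h
  have : p = q := by
    funext x
    have h1 := congrFun h (Mfld.point x)
    exact congrFun (congrArg (fun r => r.down.1) h1) Mfld.star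
  subst this
  rfl

theorem plotPresheaf_isSheaf : Presheaf.IsSheaf Mfld.openTopology (plotPresheaf X) := by
  rw [isSheaf_iff_isSheaf_of_type]
  intro M R hR s hs
  let p : M → X := fun x => (s (Mfld.point x) (Mfld.point_mem hR x)).down.1 Mfld.star
  have key : ∀ (N : Mfld) (f : N ⟶ M) (hf : R f), p ∘ f = (s f hf).down.1 := by
    intro N f hf
    funext y
    have h1 := hs (Mfld.point y) (𝟙 Mfld.pt) hf (Mfld.point_mem hR (f y)) (by simp)
    exact (congrFun (congrArg (fun r => r.down.1) h1) Mfld.star).symm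
  have hp : IsLocallyPlot M p := by
    rw [isLocallyPlot_iff]
    intro n f
    refine DiffeologicalSpace.locality fun x => ?_
    obtain ⟨U, hx, hU⟩ := hR (f x)
    refine ⟨f ⁻¹' (U : Set M), U.isOpen.preimage (Mfld.hom_smooth f).continuous, hx, ?_⟩
    intro m g hg hgs
    let g' : Mfld.euclidean m ⟶ Mfld.euclidean n :=
      Mfld.homMk (M := Mfld.euclidean m) (N := Mfld.euclidean n) g (contMDiff_iff_contDiff.2 hgs)
    have h2 := isLocallyPlot_iff.1 (s _ hU).down.2 m (Mfld.lift (g' ≫ f) U hg)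
    rw [← key _ _ hU] at h2
    exact h2
  refine ⟨⟨⟨p, hp⟩⟩, ?_, ?_⟩
  · intro N f hf
    exact congrArg ULift.up (Subtype.ext (key N f hf))
  · rintro ⟨q, hq⟩ h
    refine congrArg ULift.up (Subtype.ext ?_)
    funext x
    have h1 := h (Mfld.point x) (Mfld.point_mem hR x)
    exact congrFun (congrArg (fun r => r.down.1) h1) Mfld.star

/-- The concrete sheaf associated to a diffeological space. -/
def concreteSheafOf : ConcreteSheaf where
  obj := ⟨plotPresheaf X, plotPresheaf_isSheaf X⟩
  property := plotPresheaf_isConcrete X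

end Diffeology

/-- The quotient diffeology on the quotient of a manifold by an equivalence relation: its plots
are the maps that lift locally to smooth maps into the manifold. -/
@[reducible] def quotientDiffeology (M : Mfld) (r : Setoid M) : DiffeologicalSpace (Quotient r) :=
  DiffeologicalSpace.ofCorePlotsOn
    { isPlotOn := fun {n u} _ p => ∀ x ∈ u, ∃ v : Set (EuclideanSpace ℝ (Fin n)),
        IsOpen v ∧ x ∈ v ∧ ∃ q : EuclideanSpace ℝ (Fin n) → M,
          ContMDiffOn (𝓡 n) (𝓡 M.dim) ∞ q v ∧ ∀ y ∈ v, p y = Quotient.mk r (q y)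
      isPlotOn_congr := by
        intro n u hu p q h
        have key : ∀ p q : EuclideanSpace ℝ (Fin n) → Quotient r, Set.EqOn p q u →
            (∀ x ∈ u, ∃ v : Set (EuclideanSpace ℝ (Fin n)),
              IsOpen v ∧ x ∈ v ∧ ∃ q : EuclideanSpace ℝ (Fin n) → M,
              ContMDiffOn (𝓡 n) (𝓡 M.dim) ∞ q v ∧ ∀ y ∈ v, p y = Quotient.mk r (q y)) →
            (∀ x ∈ u, ∃ v : Set (EuclideanSpace ℝ (Fin n)),
              IsOpen v ∧ x ∈ v ∧ ∃ q' : EuclideanSpace ℝ (Fin n) → M,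
              ContMDiffOn (𝓡 n) (𝓡 M.dim) ∞ q' v ∧ ∀ y ∈ v, q y = Quotient.mk r (q' y)) := by
          intro p q h hp x hx
          obtain ⟨v, hv, hxv, l, hl, hlp⟩ := hp x hx
          exact ⟨v ∩ u, hv.inter hu, ⟨hxv, hx⟩, l, hl.mono Set.inter_subset_left,
            fun y hy => (h hy.2).symm.trans (hlp y hy.1)⟩
        exact ⟨key p q h, key q p h.symm⟩
      isPlot_const := by
        intro n x y _
        induction x using Quotient.inductionOn with | _ a
        exact ⟨Set.univ, isOpen_univ, trivial, fun _ => a, contMDiffOn_const, fun _ _ => rfl⟩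
      isPlotOn_reparam := by
        intro n m u v hu hv p f h hp hf x hx
        obtain ⟨w, hw, hxw, l, hl, hlp⟩ := hp (f x) (h hx)
        refine ⟨v ∩ f ⁻¹' w, hf.continuousOn.isOpen_inter_preimage hv hw, ⟨hx, hxw⟩, l ∘ f, ?_,
          fun y hy => hlp (f y) hy.2⟩
        exact hl.comp ((contMDiffOn_iff_contDiffOn.2 hf).mono Set.inter_subset_left)
          Set.inter_subset_right
      locality := by
        intro n u hu p hp x hx
        obtain ⟨v, hv, hxv, h⟩ := hp x hx
        exact h x hxv }

/-! ### Lie groupoids and principal bundles -/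

/-- A Lie groupoid `G₁ ⇉ G₀`. An arrow `g` goes from `s g` to `t g`, and `mul g h` is the
composition of `h` followed by `g`. Smoothness of the multiplication on the manifold
`G₁ ×_{G₀} G₁` is expressed by the universal property of this fiber product. -/
structure LieGroupoid : Type 1 where
  G₀ : Mfld
  G₁ : Mfld
  s : G₁ ⟶ G₀
  t : G₁ ⟶ G₀
  one : G₀ ⟶ G₁
  inv : G₁ ⟶ G₁
  mul : ∀ g h : G₁, s g = t h → G₁
  s_submersion : Mfld.IsSubmersion s
  t_submersion : Mfld.IsSubmersion t
  s_one : ∀ x, s (one x) = x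
  t_one : ∀ x, t (one x) = x
  s_inv : ∀ g, s (inv g) = t g
  t_inv : ∀ g, t (inv g) = s g
  s_mul : ∀ g h w, s (mul g h w) = s h
  t_mul : ∀ g h w, t (mul g h w) = t g
  mul_assoc : ∀ (g h k : G₁) (w : s g = t h) (w' : s h = t k),
    mul (mul g h w) k ((s_mul g h w).trans w') = mul g (mul h k w') (w.trans (t_mul h k w').symm)
  one_mul : ∀ g, mul (one (t g)) g (s_one _) = g
  mul_one : ∀ g, mul g (one (s g)) (t_one _).symm = g
  inv_mul : ∀ g, mul (inv g) g (s_inv g) = one (s g)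
  mul_inv : ∀ g, mul g (inv g) (t_inv g).symm = one (t g)
  smooth_mul : ∀ (N : Mfld) (a b : N ⟶ G₁) (w : ∀ x, s (a x) = t (b x)),
    ContMDiff (𝓡 N.dim) (𝓡 G₁.dim) ∞ (fun x => mul (a x) (b x) (w x))

namespace LieGroupoid

variable (G : LieGroupoid)

/-- Two objects are in the same orbit if there is an arrow between them. -/
def orbitSetoid : Setoid G.G₀ where
  r x y := ∃ g : G.G₁, G.s g = x ∧ G.t g = y
  iseqv :=
    { refl := fun x => ⟨G.one x, G.s_one x, G.t_one x⟩
      symm := by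
        rintro x y ⟨g, hs, ht⟩
        exact ⟨G.inv g, (G.s_inv g).trans ht, (G.t_inv g).trans hs⟩
      trans := by
        rintro x y z ⟨g, hs, ht⟩ ⟨h, hs', ht'⟩
        exact ⟨G.mul h g (hs'.trans ht.symm), (G.s_mul _ _ _).trans hs,
          (G.t_mul _ _ _).trans ht'⟩ }

/-- The orbit space `G₀/G₁`. -/
def OrbitSpace : Type := Quotient G.orbitSetoid

/-- The quotient diffeology on the orbit space. -/
instance : DiffeologicalSpace G.OrbitSpace := quotientDiffeology G.G₀ G.orbitSetoid

/-- A principal (right) `G`-bundle over a manifold `B`: a surjective submersion `P → B` with a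
smooth right action of `G` along an anchor map `P → G₀`, such that
`P ×_{G₀} G₁ → P ×_B P`, `(p, g) ↦ (p, p · g)` is a diffeomorphism. Smoothness of the action on
`P ×_{G₀} G₁`, and bijectivity and smoothness of the inverse of the latter map, are expressed by the
universal properties of the two fiber products (`N = *` gives bijectivity). -/
structure PrincipalBundle (B : Mfld) : Type 1 where
  total : Mfld
  proj : total ⟶ B
  anchor : total ⟶ G.G₀
  act : ∀ (p : total) (g : G.G₁), anchor p = G.t g → total
  proj_submersion : Mfld.IsSubmersion proj
  proj_surjective : Function.Surjective proj
  anchor_act : ∀ p g w, anchor (act p g w) = G.s g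
  proj_act : ∀ p g w, proj (act p g w) = proj p
  act_one : ∀ p, act p (G.one (anchor p)) (G.t_one _).symm = p
  act_mul : ∀ (p : total) (g h : G.G₁) (w : anchor p = G.t g) (w' : G.s g = G.t h),
    act p (G.mul g h w') (w.trans (G.t_mul g h w').symm) =
      act (act p g w) h ((anchor_act p g w).trans w')
  smooth_act : ∀ (N : Mfld) (a : N ⟶ total) (b : N ⟶ G.G₁) (w : ∀ x, anchor (a x) = G.t (b x)),
    ContMDiff (𝓡 N.dim) (𝓡 total.dim) ∞ (fun x => act (a x) (b x) (w x))
  principal : ∀ (N : Mfld) (a b : N ⟶ total), (∀ x, proj (a x) = proj (b x)) →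
    ∃! d : N ⟶ G.G₁, ∃ w : ∀ x, anchor (a x) = G.t (d x), ∀ x, act (a x) (d x) (w x) = b x

/-- Objects of `BG`: principal `G`-bundles over arbitrary manifolds. -/
structure BundleObj : Type 1 where
  base : Mfld
  bundle : G.PrincipalBundle base

variable {G}

/-- Arrows of `BG`: `G`-equivariant smooth maps of principal bundles covering a smooth map of the
bases. -/
@[ext]
structure BundleHom (P Q : G.BundleObj) : Type where
  base : P.base ⟶ Q.base
  total : P.bundle.total ⟶ Q.bundle.total
  proj_total : ∀ p, Q.bundle.proj (total p) = base (P.bundle.proj p)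
  anchor_total : ∀ p, Q.bundle.anchor (total p) = P.bundle.anchor p
  total_act : ∀ p g w, total (P.bundle.act p g w) =
    Q.bundle.act (total p) g ((anchor_total p).trans w)

instance : Category G.BundleObj where
  Hom := BundleHom
  id P :=
    { base := 𝟙 _
      total := 𝟙 _
      proj_total := fun _ => rfl
      anchor_total := fun _ => rfl
      total_act := fun _ _ _ => rfl }
  comp φ ψ :=
    { base := φ.base ≫ ψ.base
      total := φ.total ≫ ψ.total
      proj_total := fun p => by
        simp only [Mfld.comp_apply, ψ.proj_total, φ.proj_total]
      anchor_total := fun p => by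
        simp only [Mfld.comp_apply, ψ.anchor_total, φ.anchor_total]
      total_act := fun p g w => by
        simp only [Mfld.comp_apply, φ.total_act, ψ.total_act] }

variable (G)

/-- The stack `BG` of principal `G`-bundles, as a category over manifolds. -/
def B : BasedCategory.{0, 1} Mfld :=
  BasedCategory.ofFunctor (𝒳 := G.BundleObj)
    { obj := fun P => P.base
      map := fun φ => BundleHom.base φ }

end LieGroupoid

/-!
The isomorphism is induced by the orbit map of a principal bundle. If `P` is a principal
`G`-bundle over `M`, the anchors of the points in one fiber of `P` lie in one orbit, so that `P`
determines a map `M → G₀/G₁` (`PrincipalBundle.orbitMap`). It is locally a plot, because the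
submersion `P → M` has local sections (`Mfld.IsSubmersion.exists_local_section`), and it is
compatible with arrows of `BG`. An equivalence `𝒳 ≌ BG` therefore gives a map of presheaves
`π₀(𝒳) → I(G₀/G₁)` (`piZeroToPlot`). This map has two properties.

* It is injective over the point. If two bundles over the point have the same orbit, they have
  points `p` and `q` with the same anchor, and `p · g ↦ q · g` is an arrow between them; it is smooth
  because `g` depends smoothly on `p · g` by principality.
* It is locally surjective. A section of `I(G₀/G₁)` lifts locally to a smooth map `f` to `G₀`, and it
  is the orbit map of the pullback along `f` of the unit bundle `G₁ → G₀`. This pullback is taken in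
  the fibered category `𝒳`, where it exists by assumption; no fiber product of manifolds has to be
  constructed.

Since the sections of a concrete presheaf are detected on points, these two properties suffice for
`I(G₀/G₁)` to be the concretization of the sheafification of `π₀(𝒳)`
(`nonempty_concretization_sheafify_iso`). The invariance statements follow because equivalences
compose and because a diffeological space is recovered from its concrete sheaf: its points are the
sections over `*`, and its plots are the sections over the spaces `ℝⁿ`
(`exists_diffeomorphism_of_iso`).
-/

/-! ### Local sections and local lifts -/

/-- A submersion has a smooth local section through every point of its source. -/
theorem Mfld.IsSubmersion.exists_local_section {M N : Mfld} {f : M ⟶ N} (hf : Mfld.IsSubmersion f)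
    (p : M) : ∃ V : Set N, IsOpen V ∧ f p ∈ V ∧ ∃ σ : N → M,
      ContMDiffOn (𝓡 N.dim) (𝓡 M.dim) ∞ σ V ∧ ∀ y ∈ V, f (σ y) = y := by
  have h : Manifold.IsSubmersionAt (𝓡 M.dim) (𝓡 N.dim) ∞ (f : M → N) p :=
    hf.isSubmersionAt p
  have hw : ∀ z ∈ h.domChart.target,
      h.codChart (f (h.domChart.symm z)) = (h.equiv z).1 := by
    intro z hz
    have hz' : z ∈ (h.domChart.extend (𝓡 M.dim)).target := by simpa using hz
    have h1 := h.writtenInCharts hz'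
    simpa using h1
  -- In the normal form `(u, v) ↦ u` of `f`, the section keeps the second coordinate of `p`.
  let L : EuclideanSpace ℝ (Fin N.dim) → EuclideanSpace ℝ (Fin M.dim) :=
    fun u => h.equiv.symm (u, (h.equiv (h.domChart p)).2)
  have hL : ContMDiff (𝓡 N.dim) (𝓡 M.dim) ∞ L := by
    rw [contMDiff_iff_contDiff]
    exact h.equiv.symm.contDiff.comp (contDiff_id.prodMk contDiff_const)
  have hLw : ∀ y, (h.equiv (L y)).1 = y := fun y => by simp [L]
  have hcod : ContMDiffOn (𝓡 N.dim) (𝓡 N.dim) ∞ h.codChart h.codChart.source :=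
    contMDiffOn_of_mem_maximalAtlas h.codChart_mem_maximalAtlas
  have hdom : ContMDiffOn (𝓡 M.dim) (𝓡 M.dim) ∞ h.domChart.symm h.domChart.target :=
    contMDiffOn_symm_of_mem_maximalAtlas h.domChart_mem_maximalAtlas
  have hLc : ContMDiffOn (𝓡 N.dim) (𝓡 M.dim) ∞ (L ∘ h.codChart) h.codChart.source :=
    hL.comp_contMDiffOn hcod
  refine ⟨h.codChart.source ∩ (L ∘ h.codChart) ⁻¹' h.domChart.target,
    hLc.continuousOn.isOpen_inter_preimage h.codChart.open_source h.domChart.open_target,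
    ⟨h.mem_codChart_source, ?_⟩, fun y => h.domChart.symm (L (h.codChart y)),
    hdom.comp (hLc.mono Set.inter_subset_left) fun y hy => hy.2, ?_⟩
  · have h1 := hw _ (h.domChart.map_source h.mem_domChart_source)
    rw [h.domChart.left_inv h.mem_domChart_source] at h1
    have h2 : L (h.codChart (f p)) = h.domChart p := by
      simp only [L, h1]
      exact h.equiv.symm_apply_apply _
    rw [Set.mem_preimage, Function.comp_apply, h2]
    exact h.domChart.map_source h.mem_domChart_source
  · rintro y ⟨hy, hy'⟩
    refine h.codChart.injOn
      (h.source_subset_preimage_source (h.domChart.map_target hy')) hy ?_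
    exact (hw _ hy').trans (hLw _)

theorem isPlot_quotientDiffeology_iff {M : Mfld} {r : Setoid M} {n : ℕ}
    {p : EuclideanSpace ℝ (Fin n) → Quotient r} :
    @IsPlot _ (quotientDiffeology M r) n p ↔ ∀ x, ∃ v : Set (EuclideanSpace ℝ (Fin n)),
      IsOpen v ∧ x ∈ v ∧ ∃ q : EuclideanSpace ℝ (Fin n) → M,
        ContMDiffOn (𝓡 n) (𝓡 M.dim) ∞ q v ∧ ∀ y ∈ v, p y = Quotient.mk r (q y) :=
  ⟨fun h x => h x trivial, fun h x _ => h x⟩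

/-- For the quotient diffeology, the maps on a manifold that are locally plots are the maps that
lift locally to smooth maps. -/
theorem isLocallyPlot_quotientDiffeology_iff {M N : Mfld} {r : Setoid N} {p : M → Quotient r} :
    @IsLocallyPlot _ (quotientDiffeology N r) M p ↔ ∀ x, ∃ V : Set M, IsOpen V ∧ x ∈ V ∧
      ∃ q : M → N, ContMDiffOn (𝓡 M.dim) (𝓡 N.dim) ∞ q V ∧ ∀ y ∈ V, p y = Quotient.mk r (q y) := by
  let := quotientDiffeology N r
  constructor
  · intro hp x
    obtain ⟨e, he, hx, hpe⟩ := hp x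
    obtain ⟨δ, hδ, hball⟩ := Metric.isOpen_iff.1 e.open_target _ (e.map_source hx)
    -- Plots are defined on all of `ℝⁿ`, so a ball in the chart is first identified with `ℝⁿ`.
    let b := OpenPartialHomeomorph.univBall (e x) δ
    have hbt : b.target = Metric.ball (e x) δ := OpenPartialHomeomorph.univBall_target _ hδ
    have hbs : b.source = Set.univ := OpenPartialHomeomorph.univBall_source _ _
    have hplot := hpe M.dim b
      (fun z => hball (hbt ▸ b.map_source (hbs ▸ Set.mem_univ z)))
      OpenPartialHomeomorph.contDiff_univBall
    obtain ⟨v, hv, hxv, q, hq, hpq⟩ := isPlot_quotientDiffeology_iff.1 hplot 0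
    have hes : ContMDiffOn (𝓡 M.dim) (𝓡 M.dim) ∞ e e.source :=
      contMDiffOn_of_mem_maximalAtlas he
    have hbsm : ContMDiffOn (𝓡 M.dim) (𝓡 M.dim) ∞ b.symm (Metric.ball (e x) δ) :=
      contMDiffOn_iff_contDiffOn.2 OpenPartialHomeomorph.contDiffOn_univBall_symm
    have hc : ContMDiffOn (𝓡 M.dim) (𝓡 M.dim) ∞ (b.symm ∘ e)
        (e.source ∩ e ⁻¹' Metric.ball (e x) δ) :=
      hbsm.comp (hes.mono Set.inter_subset_left) Set.inter_subset_right
    refine ⟨(e.source ∩ e ⁻¹' Metric.ball (e x) δ) ∩ (b.symm ∘ e) ⁻¹' v,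
      hc.continuousOn.isOpen_inter_preimage
        (hes.continuousOn.isOpen_inter_preimage e.open_source Metric.isOpen_ball) hv,
      ⟨⟨hx, Metric.mem_ball_self hδ⟩, ?_⟩, q ∘ b.symm ∘ e,
      hq.comp (hc.mono Set.inter_subset_left) Set.inter_subset_right, ?_⟩
    · have : b.symm (e x) = 0 := OpenPartialHomeomorph.univBall_symm_apply_center _ _
      change b.symm (e x) ∈ v
      rwa [this]
    · rintro y ⟨⟨hy, hyb⟩, hyv⟩
      have h1 : e.symm (b (b.symm (e y))) = y := by
        rw [b.right_inv (by rw [hbt]; exact hyb), e.left_inv hy]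
      have h2 := hpq _ hyv
      simp only [Function.comp_apply, h1] at h2
      exact h2
  · intro hp
    rw [isLocallyPlot_iff]
    intro n f
    rw [isPlot_quotientDiffeology_iff]
    intro x
    obtain ⟨V, hV, hxV, q, hq, hpq⟩ := hp (f x)
    exact ⟨f ⁻¹' V, hV.preimage (Mfld.hom_smooth f).continuous, hxV, q ∘ f,
      hq.comp (Mfld.hom_smooth f).contMDiffOn (Set.Subset.refl _), fun y hy => hpq _ hy⟩

/-! ### The orbit map of a principal bundle -/

namespace LieGroupoid

variable {G : LieGroupoid}

/-- The class of a point of `G₀` in the orbit space. -/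
def orbit (x : G.G₀) : G.OrbitSpace := Quotient.mk G.orbitSetoid x

theorem orbit_eq_iff {x y : G.G₀} : orbit x = orbit y ↔ ∃ g : G.G₁, G.s g = x ∧ G.t g = y :=
  Quotient.eq (r := G.orbitSetoid)

namespace PrincipalBundle

variable {M : Mfld} (P : G.PrincipalBundle M)

/-- The map from the base to the orbit space that sends `x` to the common orbit of the anchors of
the points in the fiber over `x`. -/
noncomputable def orbitMap (x : M) : G.OrbitSpace :=
  orbit (P.anchor (Function.surjInv P.proj_surjective x))

variable {P}

/-- Points in the same fiber differ by an arrow, hence have anchors in the same orbit. -/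
theorem orbit_anchor_eq {p q : P.total} (h : P.proj p = P.proj q) :
    orbit (P.anchor p) = orbit (P.anchor q) := by
  obtain ⟨d, ⟨w, hd⟩, -⟩ := P.principal Mfld.pt (Mfld.point p) (Mfld.point q) (fun _ => h)
  refine (orbit_eq_iff.2 ⟨d Mfld.star, ?_, (w Mfld.star).symm⟩).symm
  rw [← P.anchor_act _ _ (w Mfld.star), hd]
  rfl

variable (P)

theorem orbitMap_proj (p : P.total) : P.orbitMap (P.proj p) = orbit (P.anchor p) :=
  orbit_anchor_eq (Function.surjInv_eq P.proj_surjective _)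

theorem isLocallyPlot_orbitMap : IsLocallyPlot M P.orbitMap := by
  refine isLocallyPlot_quotientDiffeology_iff.2 fun x => ?_
  obtain ⟨p, rfl⟩ := P.proj_surjective x
  obtain ⟨V, hV, hpV, σ, hσ, hσV⟩ := P.proj_submersion.exists_local_section p
  refine ⟨V, hV, hpV, P.anchor ∘ σ, (Mfld.hom_smooth P.anchor).comp_contMDiffOn hσ, ?_⟩
  intro y hy
  conv_lhs => rw [← hσV y hy]
  exact P.orbitMap_proj _

end PrincipalBundle

theorem BundleHom.orbitMap_base {P Q : G.BundleObj} (φ : P ⟶ Q) (x : P.base) :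
    Q.bundle.orbitMap (BundleHom.base φ x) = P.bundle.orbitMap x := by
  obtain ⟨p, rfl⟩ := P.bundle.proj_surjective x
  rw [← BundleHom.proj_total φ, Q.bundle.orbitMap_proj, P.bundle.orbitMap_proj,
    BundleHom.anchor_total φ]

/-- The unit bundle: `G₁` over `G₀` along the target map, with anchor the source map and with `G`
acting by multiplication. -/
noncomputable def unitBundle (G : LieGroupoid) : G.PrincipalBundle G.G₀ where
  total := G.G₁
  proj := G.t
  anchor := G.s
  act p g w := G.mul p g w
  proj_submersion := G.t_submersion
  proj_surjective x := ⟨G.one x, G.t_one x⟩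
  anchor_act p g w := G.s_mul p g w
  proj_act p g w := G.t_mul p g w
  act_one p := G.mul_one p
  act_mul p g h w w' := (G.mul_assoc p g h w w').symm
  smooth_act := G.smooth_mul
  principal := by
    intro N a b hab
    have inv_mul_cancel : ∀ (g h : G.G₁) (w : G.s g = G.t h),
        G.mul (G.inv g) (G.mul g h w) ((G.s_inv g).trans (G.t_mul g h w).symm) = h := by
      intro g h w
      rw [← G.mul_assoc (G.inv g) g h (G.s_inv g) w]
      simp only [G.inv_mul, w, G.one_mul]
    have mul_inv_cancel : ∀ (g h : G.G₁) (w : G.t g = G.t h),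
        G.mul g (G.mul (G.inv g) h ((G.s_inv g).trans w))
          ((G.t_inv g).symm.trans (G.t_mul _ _ _).symm) = h := by
      intro g h w
      rw [← G.mul_assoc g (G.inv g) h (G.t_inv g).symm ((G.s_inv g).trans w)]
      simp only [G.mul_inv, w, G.one_mul]
    have hw : ∀ x, G.s ((a ≫ G.inv) x) = G.t (b x) := fun x => (G.s_inv _).trans (hab x)
    refine ⟨Mfld.homMk (fun x => G.mul ((a ≫ G.inv) x) (b x) (hw x))
      (G.smooth_mul N (a ≫ G.inv) b hw), ⟨fun x => ?_, fun x => ?_⟩, ?_⟩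
    · exact (G.t_inv _).symm.trans (G.t_mul _ _ _).symm
    · exact mul_inv_cancel (a x) (b x) (hab x)
    · rintro d ⟨w, hd⟩
      ext x
      simp only [Mfld.homMk_apply, Mfld.comp_apply, ← hd]
      exact (inv_mul_cancel (a x) (d x) (w x)).symm

theorem orbitMap_unitBundle (x : G.G₀) : G.unitBundle.orbitMap x = orbit x := by
  have h := G.unitBundle.orbitMap_proj (G.one x)
  have h1 : G.unitBundle.proj (G.one x) = x := G.t_one x
  have h2 : G.unitBundle.anchor (G.one x) = x := G.s_one x
  rwa [h1, h2] at h

namespace PrincipalBundle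

/-- Two principal bundles over the point are related by a morphism as soon as some of their points
have the same anchor: if `p` and `q` do, the map sends `p · g` to `q · g`. -/
theorem exists_bundleHom_of_anchor_eq (P Q : G.PrincipalBundle Mfld.pt) (p : P.total) (q : Q.total)
    (hpq : P.anchor p = Q.anchor q) :
    ∃ φ : (⟨Mfld.pt, P⟩ : G.BundleObj) ⟶ ⟨Mfld.pt, Q⟩, BundleHom.base φ = 𝟙 Mfld.pt := by
  have hpt : ∀ a b : Mfld.pt, a = b := fun a b =>
    Subsingleton.elim (α := EuclideanSpace ℝ (Fin 0)) a b
  obtain ⟨d, ⟨w, hd⟩, -⟩ := P.principal P.total (Mfld.homMk (fun _ => p) contMDiff_const) (𝟙 _)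
    (fun _ => hpt _ _)
  have wp : ∀ x, P.anchor p = G.t (d x) := w
  have hdp : ∀ x, P.act p (d x) (wp x) = x := hd
  have hds : ∀ x, G.s (d x) = P.anchor x := fun x => by
    rw [← P.anchor_act p (d x) (wp x), hdp]
  have wq : ∀ x, Q.anchor q = G.t (d x) := fun x => hpq.symm.trans (wp x)
  have huniq : ∀ (g g' : G.G₁) (hg : P.anchor p = G.t g) (hg' : P.anchor p = G.t g'),
      P.act p g hg = P.act p g' hg' → g = g' := by
    intro g g' hg hg' h
    have := (P.principal Mfld.pt (Mfld.point p) (Mfld.point (P.act p g hg))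
      (fun _ => hpt _ _)).unique (y₁ := Mfld.point g) (y₂ := Mfld.point g')
      ⟨fun _ => hg, fun _ => rfl⟩ ⟨fun _ => hg', fun _ => h.symm⟩
    exact congrArg (fun u => u Mfld.star) this
  refine ⟨
    { base := 𝟙 _
      total := Mfld.homMk (fun x => Q.act q (d x) (wq x))
        (Q.smooth_act P.total (Mfld.homMk (fun _ => q) contMDiff_const) d wq)
      proj_total := fun _ => hpt _ _
      anchor_total := fun x => (Q.anchor_act _ _ _).trans (hds x)
      total_act := ?_ }, rfl⟩
  intro x g wg
  have hdg : d (P.act x g wg) = G.mul (d x) g ((hds x).trans wg) := by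
    refine huniq _ _ (wp _) ((wp x).trans (G.t_mul _ _ _).symm) ?_
    rw [hdp, P.act_mul p (d x) g (wp x)]
    congr 1
    exact (hdp x).symm
  have hact : ∀ (g' : G.G₁) (w' : Q.anchor q = G.t g') (h : d (P.act x g wg) = g'),
      Q.act q (d (P.act x g wg)) (wq _) = Q.act q g' w' := by
    rintro _ _ rfl
    rfl
  exact (hact _ _ hdg).trans (Q.act_mul q (d x) g (wq x) ((hds x).trans wg))

theorem exists_bundleHom_of_orbitMap_eq (P Q : G.PrincipalBundle Mfld.pt)
    (h : P.orbitMap Mfld.star = Q.orbitMap Mfld.star) :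
    ∃ φ : (⟨Mfld.pt, P⟩ : G.BundleObj) ⟶ ⟨Mfld.pt, Q⟩, BundleHom.base φ = 𝟙 Mfld.pt := by
  obtain ⟨p, hp⟩ := P.proj_surjective Mfld.star
  obtain ⟨q, hq⟩ := Q.proj_surjective Mfld.star
  rw [← hp, P.orbitMap_proj, hp, ← hq, Q.orbitMap_proj] at h
  obtain ⟨g, hs, ht⟩ := orbit_eq_iff.1 h
  exact exists_bundleHom_of_anchor_eq P Q p (Q.act q g ht.symm)
    (hs.symm.trans (Q.anchor_act _ _ _).symm)

end PrincipalBundle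

end LieGroupoid

/-! ### Concretization and sheafification -/

/-- On a concrete presheaf, injectivity over the point implies injectivity over every manifold. -/
theorem isLocallyInjective_of_injective_pt {P Q : Mfldᵒᵖ ⥤ Type 1} (φ : P ⟶ Q)
    (hP : IsConcrete P) (h : Function.Injective (φ.app (op Mfld.pt))) :
    Presheaf.IsLocallyInjective Mfld.openTopology φ where
  equalizerSieve_mem {M} p q hpq := by
    have : p = q := by
      refine hP M.unop (funext fun u => h ?_)
      have h1 := congrArg (Q.map u.op) hpq
      simpa [NatTrans.naturality_apply] using h1
    subst this
    simp

/-- A covering sieve of the point contains the identity, so that every section of the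
sheafification over the point comes from the presheaf. -/
theorem toSheafify_app_pt_surjective (P : Mfldᵒᵖ ⥤ Type 1) :
    Function.Surjective ((toSheafify Mfld.openTopology P).app (op Mfld.pt)) := by
  intro s
  have h : Presheaf.imageSieve (U := Mfld.pt) (toSheafify Mfld.openTopology P) s (𝟙 Mfld.pt) := by
    rw [Mfld.eq_point (𝟙 Mfld.pt)]
    exact Mfld.point_mem
      (Presheaf.imageSieve_mem Mfld.openTopology (toSheafify Mfld.openTopology P) s) _
  obtain ⟨a, ha⟩ := h
  exact ⟨a, by simpa using ha⟩

/-- A map from `P` to a concrete presheaf factors through `κ(P)`. -/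
def kappaDesc {P Q : Mfldᵒᵖ ⥤ Type 1} (φ : P ⟶ Q) (hQ : IsConcrete Q) : kappa P ⟶ Q where
  app M := ↾(Quotient.lift (φ.app M) (by
    intro p q hpq
    refine hQ M.unop (funext fun u => ?_)
    have h1 := congrArg (φ.app (op Mfld.pt)) (hpq u)
    simpa [NatTrans.naturality_apply] using h1))
  naturality M N f := by
    ext x
    induction x using Quotient.inductionOn with | _ p
    exact NatTrans.naturality_apply φ f p

/-- A presheaf map to a concrete sheaf that is injective on the point and locally surjective
exhibits the target as the concretization of the sheafification of the source. -/
theorem nonempty_concretization_sheafify_iso {P : Mfldᵒᵖ ⥤ Type 1} (S : ConcreteSheaf)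
    (φ : P ⟶ S.obj.obj) (hinj : Function.Injective (φ.app (op Mfld.pt)))
    (hsurj : Presheaf.IsLocallySurjective Mfld.openTopology φ) :
    Nonempty (concretization ((presheafToSheaf Mfld.openTopology (Type 1)).obj P).obj ≅ S) := by
  let J := Mfld.openTopology
  let η : P ⟶ sheafify J P := toSheafify J P
  let ψ : sheafify J P ⟶ S.obj.obj := sheafifyLift J φ S.obj.property
  have hηψ : η ≫ ψ = φ := toSheafify_sheafifyLift J φ S.obj.property
  let κψ : kappa (sheafify J P) ⟶ S.obj.obj := kappaDesc ψ S.property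
  let ξ : P ⟶ kappa (sheafify J P) :=
    η ≫ { app := fun M => ↾(fun p => Quotient.mk _ p), naturality := fun _ _ _ => rfl }
  have hξ : ξ ≫ κψ = φ := by
    rw [← hηψ]
    rfl
  have hinj' : Function.Injective (κψ.app (op Mfld.pt)) := by
    intro a b
    induction a using Quotient.inductionOn with | _ a
    induction b using Quotient.inductionOn with | _ b
    obtain ⟨a, rfl⟩ := toSheafify_app_pt_surjective P a
    obtain ⟨b, rfl⟩ := toSheafify_app_pt_surjective P b
    intro h
    have h1 : ∀ c : P.obj (op Mfld.pt), κψ.app (op Mfld.pt) (Quotient.mk _ (η.app _ c)) =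
        φ.app _ c := fun c => ConcreteCategory.congr_hom (NatTrans.congr_app hξ (op Mfld.pt)) c
    have h2 : a = b := hinj ((h1 a).symm.trans (h.trans (h1 b)))
    rw [h2]
  have h1 : Presheaf.IsLocallyInjective J κψ :=
    isLocallyInjective_of_injective_pt κψ (kappa_isConcrete _) hinj'
  have h2 : Presheaf.IsLocallySurjective J κψ := by
    have : Presheaf.IsLocallySurjective J (ξ ≫ κψ) := by rwa [hξ]
    exact Presheaf.isLocallySurjective_of_isLocallySurjective J ξ κψ
  have h3 : IsIso ((presheafToSheaf J (Type 1)).map κψ) :=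
    (J.W_iff κψ).1 (J.W_of_isLocallyBijective κψ)
  exact ⟨ObjectProperty.isoMk _
    (@asIso _ _ _ _ ((presheafToSheaf J (Type 1)).map κψ) h3 ≪≫ (sheafificationIso S.obj).symm)⟩

/-! ### Diffeological spaces as concrete sheaves -/

section Diffeology

variable {X Y : Type} [DiffeologicalSpace X] [DiffeologicalSpace Y]

theorem isLocallyPlot_euclidean_iff {n : ℕ} {p : EuclideanSpace ℝ (Fin n) → X} :
    IsLocallyPlot (Mfld.euclidean n) p ↔ IsPlot p := by
  refine isLocallyPlot_iff.trans ⟨fun h => h n (𝟙 _), fun h m f =>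
    isPlot_reparam h (contMDiff_iff_contDiff.1 (Mfld.hom_smooth f))⟩

/-- A constant map, as a section over the point. -/
def constSection (x : X) : (plotPresheaf X).obj (op Mfld.pt) :=
  ⟨fun _ => x, isLocallyPlot_euclidean_iff.2 isPlot_const⟩

/-- The map `X → Y` underlying a morphism of the associated concrete sheaves: its effect on
sections over the point. -/
def mapOfHom (φ : plotPresheaf X ⟶ plotPresheaf Y) (x : X) : Y :=
  (φ.app (op Mfld.pt) (constSection x)).down.1 Mfld.star

theorem mapOfHom_comp (φ : plotPresheaf X ⟶ plotPresheaf Y) (M : Mfld)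
    (p : (plotPresheaf X).obj (op M)) :
    mapOfHom φ ∘ p.down.1 = (φ.app (op M) p).down.1 := by
  funext x
  have h := NatTrans.naturality_apply φ (Mfld.point x).op p
  exact congrFun (congrArg (fun r => r.down.1) h) Mfld.star

theorem dSmooth_mapOfHom (φ : plotPresheaf X ⟶ plotPresheaf Y) : DSmooth (mapOfHom φ) := by
  intro n p hp
  have h := mapOfHom_comp φ (Mfld.euclidean n) ⟨⟨p, isLocallyPlot_euclidean_iff.2 hp⟩⟩
  rw [← isLocallyPlot_euclidean_iff]
  exact h ▸ (φ.app (op (Mfld.euclidean n)) _).down.2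

theorem mapOfHom_mapOfHom {φ : plotPresheaf X ⟶ plotPresheaf Y}
    {ψ : plotPresheaf Y ⟶ plotPresheaf X} (h : φ ≫ ψ = 𝟙 _) (x : X) :
    mapOfHom ψ (mapOfHom φ x) = x := by
  have h1 := congrFun (mapOfHom_comp ψ Mfld.pt (φ.app _ (constSection x))) Mfld.star
  have h2 := ConcreteCategory.congr_hom (NatTrans.congr_app h (op Mfld.pt)) (constSection x)
  exact h1.trans (congrFun (congrArg (fun r => r.down.1) h2) Mfld.star)

/-- Diffeological spaces with isomorphic concrete sheaves are diffeomorphic. -/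
theorem exists_diffeomorphism_of_iso (e : concreteSheafOf X ≅ concreteSheafOf Y) :
    ∃ f : X ≃ Y, DSmooth f ∧ DSmooth f.symm := by
  let e' : plotPresheaf X ≅ plotPresheaf Y :=
    (sheafToPresheaf _ _).mapIso ((ObjectProperty.ι _).mapIso e)
  exact ⟨{ toFun := mapOfHom e'.hom
           invFun := mapOfHom e'.inv
           left_inv := mapOfHom_mapOfHom e'.hom_inv_id
           right_inv := mapOfHom_mapOfHom e'.inv_hom_id },
    dSmooth_mapOfHom e'.hom, dSmooth_mapOfHom e'.inv⟩

end Diffeology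

/-! ### Equivalences of based categories -/

/-- The functor underlying an equivalence of based categories is an equivalence. -/
theorem CategoryTheory.BasedCategory.isEquivalence_hom {𝒴 𝒵 : BasedCategory.{0, 1} Mfld}
    (E : 𝒴 ≌ 𝒵) :
    (BasedFunctor.toFunctor E.hom).IsEquivalence :=
  (CategoryTheory.Equivalence.mk (BasedFunctor.toFunctor E.hom) (BasedFunctor.toFunctor E.inv)
    ((BasedNatTrans.forgetful 𝒴 𝒴).mapIso E.unit)
    ((BasedNatTrans.forgetful 𝒵 𝒵).mapIso E.counit)).isEquivalence_functor

theorem CategoryTheory.BasedCategory.nonempty_equivalence_of_equivalence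
    {𝒳 𝒴 𝒵 : BasedCategory.{0, 1} Mfld} (D : 𝒳 ≌ 𝒴) (E : 𝒳 ≌ 𝒵) : Nonempty (𝒴 ≌ 𝒵) := by
  let u : 𝟙 𝒴 ≅ (D.inv ≫ E.hom) ≫ E.inv ≫ D.hom :=
    D.counit.symm ≪⊗≫ Bicategory.whiskerLeftIso D.inv (Bicategory.whiskerRightIso E.unit D.hom)
      ≪⊗≫ Iso.refl _
  let c : (E.inv ≫ D.hom) ≫ D.inv ≫ E.hom ≅ 𝟙 𝒵 :=
    Iso.refl _ ≪⊗≫ Bicategory.whiskerLeftIso E.inv (Bicategory.whiskerRightIso D.unit.symm E.hom)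
      ≪⊗≫ E.counit
  exact ⟨Bicategory.Equivalence.mkOfAdjointifyCounit u c⟩

/-! ### The orbit map of an object of a stack -/

namespace LieGroupoid

variable {G : LieGroupoid}

/-- The orbit map of a principal bundle `Q` with base equal to `M`, as a section over `M`. -/
noncomputable def orbitSection {M : Mfld} (Q : G.B.obj) (hQ : G.B.p.obj Q = M) :
    (plotPresheaf G.OrbitSpace).obj (op M) :=
  (plotPresheaf G.OrbitSpace).map (eqToHom hQ.symm).op
    ⟨⟨PrincipalBundle.orbitMap (BundleObj.bundle Q), PrincipalBundle.isLocallyPlot_orbitMap _⟩⟩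

/-- Orbit sections are compatible with arrows of `BG`. -/
theorem orbitSection_of_isHomLift {M N : Mfld} (f : N ⟶ M) {Q Q' : G.B.obj} (φ : Q ⟶ Q')
    [hφ : G.B.p.IsHomLift f φ] (hQ : G.B.p.obj Q = N) (hQ' : G.B.p.obj Q' = M) :
    orbitSection Q hQ = (plotPresheaf G.OrbitSpace).map f.op (orbitSection Q' hQ') := by
  have hf := IsHomLift.fac G.B.p f φ
  subst hQ hQ'
  simp only [eqToHom_refl, Category.id_comp, Category.comp_id] at hf
  subst hf
  refine congrArg ULift.up (Subtype.ext (funext fun x => ?_))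
  exact (BundleHom.orbitMap_base (G := G) φ x).symm

/-- Principal bundles over the point with the same orbit section are related by an arrow. -/
theorem exists_isHomLift_of_orbitSection_eq {Q Q' : G.B.obj} (hQ : G.B.p.obj Q = Mfld.pt)
    (hQ' : G.B.p.obj Q' = Mfld.pt) (h : orbitSection Q hQ = orbitSection Q' hQ') :
    ∃ φ : Q ⟶ Q', G.B.p.IsHomLift (𝟙 Mfld.pt) φ := by
  obtain ⟨M, P⟩ := Q
  obtain ⟨M', P'⟩ := Q'
  obtain rfl : M = Mfld.pt := hQ
  obtain rfl : M' = Mfld.pt := hQ'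
  obtain ⟨φ, hφ⟩ := P.exists_bundleHom_of_orbitMap_eq P'
    (congrFun (congrArg (fun r => r.down.1) h) Mfld.star)
  refine ⟨φ, IsHomLift.of_fac' G.B.p _ _ rfl rfl ?_⟩
  exact hφ

section

variable (𝒳 : BasedCategory.{0, 1} Mfld) [IsFiberedInGroupoids 𝒳]

/-- The map from `π₀(𝒳)` to the sheaf of the orbit space that is induced by a functor
`F : 𝒳 ⟶ BG`: it sends the class of an object to the orbit map of its bundle. -/
noncomputable def piZeroToPlot (F : BasedFunctor 𝒳 G.B) :
    piZero 𝒳 ⟶ plotPresheaf G.OrbitSpace where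
  app M := ↾(Quotient.lift
    (fun a : 𝒳.p.Fiber M.unop => orbitSection (F.obj a.1) ((F.w_obj a.1).trans a.2)) (by
      rintro a b ⟨e⟩
      have : 𝒳.p.IsHomLift (𝟙 M.unop) e.hom.1 := e.hom.2
      have h := orbitSection_of_isHomLift (𝟙 M.unop) (F.map e.hom.1)
        ((F.w_obj a.1).trans a.2) ((F.w_obj b.1).trans b.2)
      simpa using h))
  naturality M N f := by
    ext x
    induction x using Quotient.inductionOn with | _ a
    exact orbitSection_of_isHomLift f.unop
      (F.map (Functor.IsPreFibered.pullbackMap a.2 f.unop))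
      ((F.w_obj _).trans (pullbackFiber 𝒳 f.unop a).2) ((F.w_obj a.1).trans a.2)

variable {𝒳}

/-- Bundles over the point with the same orbit are related by an arrow of `BG`, which comes from an
arrow of `𝒳` since `E` is full, and that arrow is invertible since the fibers are groupoids. -/
theorem piZeroToPlot_app_pt_injective (E : 𝒳 ≌ G.B) :
    Function.Injective ((piZeroToPlot 𝒳 E.hom).app (op Mfld.pt)) := by
  intro x y
  induction x using Quotient.inductionOn with | _ a
  induction y using Quotient.inductionOn with | _ b
  intro h
  let F : BasedFunctor 𝒳 G.B := E.hom
  have := BasedCategory.isEquivalence_hom E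
  obtain ⟨φ, hφ⟩ := exists_isHomLift_of_orbitSection_eq ((F.w_obj a.1).trans a.2)
    ((F.w_obj b.1).trans b.2) h
  obtain ⟨ψ, rfl⟩ := F.toFunctor.map_surjective φ
  have hψ : 𝒳.p.IsHomLift (𝟙 Mfld.pt) ψ := (F.isHomLift_iff _ ψ).1 hφ
  let ψ' : a ⟶ b := ⟨ψ, hψ⟩
  exact Quotient.sound ⟨asIso ψ'⟩

/-- The orbit space is covered by `G₀`, over which the unit bundle provides an object of `𝒳`; its
pullbacks along local lifts realize every section locally. -/
theorem piZeroToPlot_isLocallySurjective (E : 𝒳 ≌ G.B) :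
    Presheaf.IsLocallySurjective Mfld.openTopology (piZeroToPlot 𝒳 E.hom) where
  imageSieve_mem {M} s := by
    let F : BasedFunctor 𝒳 G.B := E.hom
    let K : BasedFunctor G.B 𝒳 := E.inv
    let U : G.B.obj := (⟨G.G₀, G.unitBundle⟩ : G.BundleObj)
    let a : 𝒳.p.Fiber G.G₀ := ⟨K.obj U, K.w_obj U⟩
    have ha : orbitSection (F.obj a.1) ((F.w_obj a.1).trans a.2) = orbitSection U rfl := by
      let β : BasedNatTrans (K.comp F) (BasedFunctor.id G.B) := E.counit.hom
      have hlift : G.B.p.IsHomLift (𝟙 G.G₀) (β.app U) := β.isHomLift' U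
      have h := orbitSection_of_isHomLift (𝟙 G.G₀) (β.app U) ((F.w_obj a.1).trans a.2) rfl
      exact h
    intro x
    obtain ⟨V, hV, hxV, q, hq, hsq⟩ := isLocallyPlot_quotientDiffeology_iff.1 s.down.2 x
    refine ⟨⟨V, hV⟩, hxV, ?_⟩
    let W : TopologicalSpace.Opens M := ⟨V, hV⟩
    have hqW : ContMDiff (𝓡 M.dim) (𝓡 G.G₀.dim) ∞ (fun y : W => q y.1) :=
      hq.comp_contMDiff (contMDiff_subtype_val (I := 𝓡 M.dim)) fun y => y.2
    let f : M.ofOpens W ⟶ G.G₀ := Mfld.homMk (M := M.ofOpens W) (fun y => q y.1) hqW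
    let α : (piZero 𝒳).obj (op G.G₀) := Quotient.mk _ a
    refine ⟨(piZero 𝒳).map f.op α, ?_⟩
    refine (NatTrans.naturality_apply (piZeroToPlot 𝒳 E.hom) f.op α).trans ?_
    refine (congrArg ((plotPresheaf G.OrbitSpace).map f.op) ha).trans ?_
    refine congrArg ULift.up (Subtype.ext (funext fun y => ?_))
    exact (orbitMap_unitBundle (q y.1)).trans (hsq y.1 y.2).symm

/-- The coarse moduli space of a stack represented by `G` is the orbit space. -/
theorem nonempty_coarse_iso (E : 𝒳 ≌ G.B) :
    Nonempty (coarse 𝒳 ≅ concreteSheafOf G.OrbitSpace) :=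
  nonempty_concretization_sheafify_iso (concreteSheafOf G.OrbitSpace) (piZeroToPlot 𝒳 E.hom)
    (piZeroToPlot_app_pt_injective E) (piZeroToPlot_isLocallySurjective E)

end

end LieGroupoid

theorem theorem4 (𝒳 : BasedCategory.{0, 1} Mfld) [IsStack 𝒳] (G : LieGroupoid)
    (hG : Nonempty (𝒳 ≌ G.B)) :
    Nonempty (coarse 𝒳 ≅ concreteSheafOf G.OrbitSpace) ∧
      ∀ (𝒴 : BasedCategory.{0, 1} Mfld) [IsStack 𝒴], Nonempty (𝒳 ≌ 𝒴) →
        Nonempty (coarse 𝒳 ≅ coarse 𝒴) ∧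
          ∀ H : LieGroupoid, Nonempty (𝒴 ≌ H.B) →
            ∃ e : G.OrbitSpace ≃ H.OrbitSpace, DSmooth e ∧ DSmooth e.symm := by
  obtain ⟨E⟩ := hG
  obtain ⟨i⟩ := LieGroupoid.nonempty_coarse_iso E
  refine ⟨⟨i⟩, fun 𝒴 _ ⟨D⟩ => ?_⟩
  obtain ⟨E₁⟩ := BasedCategory.nonempty_equivalence_of_equivalence D E
  obtain ⟨j⟩ := LieGroupoid.nonempty_coarse_iso E₁
  refine ⟨⟨i ≪≫ j.symm⟩, fun H ⟨E'⟩ => ?_⟩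
  obtain ⟨k⟩ := LieGroupoid.nonempty_coarse_iso E'
  exact exists_diffeomorphism_of_iso (j.symm ≪≫ k)
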